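/- Consider patterns $\boldsymbol i=(i_1,\dots,i_m)$ of $m$ bosonic channels, where $i_k\in\{B,T\}$ says whether the $k$-th channel is a background ($B$) or a target ($T$) channel. A channel of type $x\in\{B,T\}$ is a Gaussian phase-insensitive channel with transmissivity $\tau_x\ge 0$ and induced noise $\nu_x\ge |1-\tau_x|/2$. Let $\boldsymbol s\subseteq\{1,\dots,m\}$ with $|\boldsymbol s|=k\ge 2$ and let $\mu\ge\tfrac12$. Let $V_\mu^{\boldsymbol s}$ be the covariance matrix (vacuum $=\tfrac12 I$) of the CV-GHZ state on the modes in $\boldsymbol s$: its diagonal $2\times2$ blocks are $\mu I$ and its off-diagonal $2\times 2$ blocks are $\mathrm{diag}(c,-c)$ with $c=\sqrt{\mu^2-1/4}/(k-1)$. For a pattern $\boldsymbol i$, let $\Phi^{\boldsymbol s}_{\mu,\boldsymbol i}$ be the zero-mean Gaussian state of the modes in $\boldsymbol s$ with covariance matrix $$\Big(\bigoplus_{l\in\boldsymbol s}\sqrt{\tau_{i_l}}\,I\Big)V_\mu^{\boldsymbol s}\Big(\bigoplus_{l\in\boldsymbol s}\sqrt{\tau_{i_l}}\,I\Big)^T+\bigoplus_{l\in\boldsymbol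 s}\nu_{i_l}I ,$$ that is, the output of the GHZ sub-state after probing the channels in $\boldsymbol s$. Write $\boldsymbol i[\boldsymbol s]=(i_l)_{l\in\boldsymbol s}$ for the local pattern and $F(\rho,\sigma)=\mathrm{Tr}\sqrt{\sqrt\rho\,\sigma\sqrt\rho}$ for the Bures fidelity. Let $v,u\ge 0$ and $d>0$ be integers, let $\mathcal U$ be a set of local patterns on $\boldsymbol s$ each having exactly $v$ target channels, and let $\mathcal V$ be a set of local patterns on $\boldsymbol s$ each having exactly $u$ target channels. Then the sub-fidelity $F(\Phi^{\boldsymbol s}_{\mu,\boldsymbol i},\Phi^{\boldsymbol s}_{\mu,\boldsymbol i'})$ takes the same value for all patterns $\boldsymbol i,\boldsymbol i'$ with $\boldsymbol i[\boldsymbol s]\in\mathcal U$, $\boldsymbol i'[\boldsymbol s]\in\mathcal V$ and $\mathrm{hamming}(\boldsymbol i[\boldsymbol s],\boldsymbol i'[\boldsymbol s])=d$. -/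

import Mathlib

open MeasureTheory
open scoped ENNReal

noncomputable section

/-! Operators on a complex Hilbert space: traces and the Bures fidelity. -/

/-- `HasTrace A z`: the bounded operator `A` has trace `z`, that is, the diagonal sum of `A`
in every orthonormal (Hilbert) basis converges unconditionally to `z`. -/
def HasTrace {H : Type} [NormedAddCommGroup H] [InnerProductSpace ℂ H]
    (A : H →L[ℂ] H) (z : ℂ) : Prop :=
  ∀ (ι : Type) (b : HilbertBasis ι ℂ H), HasSum (fun n => inner ℂ (b n) (A (b n))) z

/-- The trace in `[0, ∞]` of a positive operator `A`: the supremum, over all finite orthonormal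
families, of the sum of the diagonal entries of `A`. For positive `A` this is the diagonal sum
in any orthonormal basis. -/
def posTrace {H : Type} [NormedAddCommGroup H] [InnerProductSpace ℂ H]
    (A : H →L[ℂ] H) : ℝ≥0∞ :=
  ⨆ (t : Finset H) (_ : Orthonormal ℂ (fun e : t => (e : H))),
    ∑ e ∈ t, ENNReal.ofReal (inner ℂ e (A e)).re

/-- A quantum state (density operator): a positive operator of trace one. -/
def IsState {H : Type} [NormedAddCommGroup H] [InnerProductSpace ℂ H]
    (ρ : H →L[ℂ] H) : Prop :=
  ρ.IsPositive ∧ HasTrace ρ 1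

/-- The Bures fidelity `F(ρ, σ) = Tr √(√ρ σ √ρ)`. -/
def fidelity {H : Type} [NormedAddCommGroup H] [InnerProductSpace ℂ H] [CompleteSpace H]
    (ρ σ : H →L[ℂ] H) : ℝ≥0∞ :=
  posTrace (CFC.sqrt (CFC.sqrt ρ * σ * CFC.sqrt ρ))

/-! Bosonic modes labelled by a finite type `ι`. A phase-space vector is `r : ι × Fin 2 → ℝ`,
where `(k, 0)` is the position slot and `(k, 1)` the momentum slot of mode `k`. -/

/-- The Hilbert space `L²(ℝ^ι; ℂ)` of the modes labelled by `ι`. -/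
abbrev ModeSpace (ι : Type) [Fintype ι] : Type :=
  Lp ℂ 2 (volume : Measure (ι → ℝ))

/-- The unimodular function `q ↦ exp (i (∑ₖ aₖ qₖ + ½ ∑ₖ aₖ bₖ))`, where `a` and `b` are the
position and the momentum parts of `r`. -/
def weylPhase {ι : Type} [Fintype ι] (r : ι × Fin 2 → ℝ) (q : ι → ℝ) : ℂ :=
  Complex.exp (((∑ k, r (k, 0) * q k + (∑ k, r (k, 0) * r (k, 1)) / 2 : ℝ) : ℂ) * Complex.I)

theorem memLp_weylPhase {ι : Type} [Fintype ι] (r : ι × Fin 2 → ℝ) :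
    MemLp (weylPhase r) ∞ (volume : Measure (ι → ℝ)) := by
  have hc : Continuous (weylPhase r) := by
    unfold weylPhase
    fun_prop
  refine memLp_top_of_bound hc.aestronglyMeasurable 1 (Filter.Eventually.of_forall fun q => ?_)
  exact (Complex.norm_exp_ofReal_mul_I _).le

/-- The Weyl operator `exp (i ∑ₖ (aₖ Q̂ₖ + bₖ P̂ₖ))` with `a = r (·, 0)` and `b = r (·, 1)`, where
`Q̂ₖ` is multiplication by `qₖ` and `P̂ₖ = -i ∂/∂qₖ` (so `[Q̂ₖ, P̂ₖ] = i`). It acts as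
`f ↦ (q ↦ exp (i (∑ₖ aₖ qₖ + ½ ∑ₖ aₖ bₖ)) f (q + b))`. -/
def weyl {ι : Type} [Fintype ι] (r : ι × Fin 2 → ℝ) : ModeSpace ι →L[ℂ] ModeSpace ι :=
  ((ContinuousLinearMap.mul ℂ ℂ).holderL volume ∞ 2 2 (memLp_weylPhase r).toLp).comp
    (Lp.compMeasurePreservingₗᵢ ℂ (fun q : ι → ℝ => q + fun k => r (k, 1))
      (measurePreserving_add_right volume _)).toContinuousLinearMap

theorem weyl_apply {ι : Type} [Fintype ι] (r : ι × Fin 2 → ℝ) (f : ModeSpace ι) :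
    ∀ᵐ q : ι → ℝ, weyl r f q = weylPhase r q * f (q + fun k => r (k, 1)) := by
  have h1 := (ContinuousLinearMap.mul ℂ ℂ).coeFn_holder (r := 2) (μ := (volume : Measure (ι → ℝ)))
    (memLp_weylPhase r).toLp
    (Lp.compMeasurePreserving (fun q : ι → ℝ => q + fun k => r (k, 1))
      (measurePreserving_add_right volume _) f)
  have h2 := (memLp_weylPhase r).coeFn_toLp
  have h3 := Lp.coeFn_compMeasurePreserving f
    (measurePreserving_add_right (volume : Measure (ι → ℝ)) fun k => r (k, 1))
  filter_upwards [h1, h2, h3] with q e1 e2 e3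
  refine e1.trans ?_
  rw [e2, e3]
  rfl

/-- `ρ` is the Gaussian state with zero first moments and covariance matrix `V` (symmetrised
second moments, the vacuum having `V = ½ I`): a state whose characteristic function
`r ↦ Tr (ρ exp (i r · R̂))`, with `R̂` the vector of quadratures, is `exp (-½ rᵀ V r)`. -/
def IsGaussianState {ι : Type} [Fintype ι] (V : Matrix (ι × Fin 2) (ι × Fin 2) ℝ)
    (ρ : ModeSpace ι →L[ℂ] ModeSpace ι) : Prop :=
  IsState ρ ∧ ∀ r : ι × Fin 2 → ℝ,
    HasTrace (ρ * weyl r) ((Real.exp (-(r ⬝ᵥ V.mulVec r) / 2) : ℝ) : ℂ)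

/-- The maximal correlation parameter `√(μ² - 1/4) / (k - 1)` of a GHZ state of `k` modes. -/
def ghzCorr (k : ℕ) (μ : ℝ) : ℝ := Real.sqrt (μ ^ 2 - 1 / 4) / ((k : ℝ) - 1)

/-- The covariance matrix of the bosonic GHZ state on the modes `ι` with energy `μ`: each
diagonal `2 × 2` block is `μ I`, each off-diagonal block is `diag (c, -c)` with `c` the maximal
correlation parameter. -/
def ghzCov (ι : Type) [Fintype ι] [DecidableEq ι] (μ : ℝ) :
    Matrix (ι × Fin 2) (ι × Fin 2) ℝ :=
  Matrix.of fun x y =>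
    if x.2 = y.2 then
      if x.1 = y.1 then μ
      else if x.2 = 0 then ghzCorr (Fintype.card ι) μ
      else -ghzCorr (Fintype.card ι) μ
    else 0

/-- `(τ, ν)` are the transmissivity and the induced noise of a Gaussian phase-insensitive channel
(pure loss, thermal loss, amplifier, additive noise). -/
def IsGPIChannel (τ ν : ℝ) : Prop := 0 ≤ τ ∧ |1 - τ| / 2 ≤ ν

/-- The matrix `⨁ₖ x_{iₖ} I` (`2 × 2` identity blocks) of a channel property `x` along the
pattern `i`. In a pattern, `true` marks a target channel and `false` a background channel. -/
def patternMatrix {ι : Type} [DecidableEq ι] (x : Bool → ℝ) (i : ι → Bool) :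
    Matrix (ι × Fin 2) (ι × Fin 2) ℝ :=
  Matrix.diagonal fun y => x (i y.1)

/-- The action on covariance matrices of the multi-channel with pattern `i`, whose target and
background channels have transmissivities `τ` and noises `ν`. -/
def multiChannelCov {ι : Type} [Fintype ι] [DecidableEq ι] (τ ν : Bool → ℝ) (i : ι → Bool)
    (V : Matrix (ι × Fin 2) (ι × Fin 2) ℝ) : Matrix (ι × Fin 2) (ι × Fin 2) ℝ :=
  patternMatrix (fun x => Real.sqrt (τ x)) i * V *
      (patternMatrix (fun x => Real.sqrt (τ x)) i).transpose +
    patternMatrix ν i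

/-- The local pattern `i[s]`, the restriction of an `m`-channel pattern `i` to the channels
in `s`. -/
def localPattern {m : ℕ} (i : Fin m → Bool) (s : Finset (Fin m)) : s → Bool := fun k => i k

/-- `ρ` is the output sub-state `Φ^s_{μ,i}`: the GHZ state of energy `μ` on the modes in `s` after
these modes have probed the channels in `s` of the pattern `i`. -/
def IsOutputSubState {m : ℕ} (s : Finset (Fin m)) (μ : ℝ) (τ ν : Bool → ℝ) (i : Fin m → Bool)
    (ρ : ModeSpace s →L[ℂ] ModeSpace s) : Prop :=
  IsGaussianState (multiChannelCov τ ν (localPattern i s) (ghzCov s μ)) ρ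

/-- The image space of channel position finding on the channels `ι`: all patterns with exactly
`v` target channels. -/
def cpfSpace (ι : Type) [Fintype ι] (v : ℕ) : Set (ι → Bool) :=
  {p | (Finset.univ.filter fun k => p k = true).card = v}

end

/-!
The modes in `s` enter the GHZ covariance matrix symmetrically, so an output state depends on the
pattern only up to a relabelling of the modes. The weights `v` and `u` of two local patterns and
their Hamming distance `d` fix how many positions carry each of the four pairs of channel types.
Hence any two pairs of patterns with the same data differ by one common permutation of the modes
(`exists_perm_pattern_pair`). This permutation acts on `L²(ℝ^s)` by a unitary operator that permutes
the Weyl operators (`permUnitary_weyl`) and therefore carries the Gaussian states of the one pair to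
Gaussian states with the covariance matrices of the other, and the fidelity is invariant under
unitaries (`fidelity_conjStarAlgEquiv`).

What remains is that a density operator `ρ` is determined by its characteristic function
`r ↦ Tr (ρ W(r))` (`IsState.eq_of_hasTrace_weyl`). The columns `√ρ eₙ` of the Hilbert-Schmidt operator
`√ρ` write `ρ` as `∑ |xₙ⟩⟨xₙ|`, and cyclicity of the trace turns `Tr (ρ W(r))` into
`∑ ⟪xₙ, W(r) xₙ⟫`. The difference of two states with equal characteristic functions is then a sum
`∑ |yₙ⟩⟨xₙ|` with `∑ ⟪xₙ, W(r) yₙ⟫ = 0` for all `r = (a, b)`. For a fixed shift `b` these numbers are,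
up to phases, the Fourier transform in `a` of the integrable function
`q ↦ ∑ conj (xₙ q) yₙ (q + b)`, the kernel of the difference along a diagonal. So the kernel
vanishes on every diagonal, and integrating over the diagonals shows that the operator vanishes.
-/

/-! ### Fourier uniqueness and series of integrable functions -/

theorem integrable_tsum_of_summable_integral_norm {α κ : Type*} [MeasurableSpace α] {μ : Measure α}
    [Countable κ] {F : κ → α → ℂ} (hF : ∀ n, Integrable (F n) μ)
    (hs : Summable fun n => ∫ a, ‖F n a‖ ∂μ) : Integrable (fun a => ∑' n, F n a) μ := by
  refine ⟨(AEMeasurable.tsum fun n => (hF n).1.aemeasurable).aestronglyMeasurable, ?_⟩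
  have h (n : κ) : ∫⁻ a, ‖F n a‖ₑ ∂μ = ENNReal.ofReal (∫ a, ‖F n a‖ ∂μ) :=
    (ofReal_integral_norm_eq_lintegral_enorm (hF n)).symm
  refine lt_of_le_of_lt (lintegral_mono fun a => enorm_tsum_le_tsum_enorm) ?_
  rw [lintegral_tsum fun n => (hF n).1.enorm, tsum_congr h]
  exact hs.tsum_ofReal_lt_top

/-- Fourier uniqueness for real functions: the positive and the negative part of `h` are densities of
finite measures with the same characteristic function. -/
theorem ae_eq_zero_of_integral_exp_mul_ofReal_eq_zero {E : Type*} [NormedAddCommGroup E]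
    [NormedSpace ℝ E] [MeasurableSpace E] [BorelSpace E] [SecondCountableTopology E]
    [CompleteSpace E] {μ : Measure E} {h : E → ℝ} (hh : Integrable h μ)
    (h0 : ∀ L : StrongDual ℝ E, ∫ x, Complex.exp (L x * Complex.I) * (h x : ℂ) ∂μ = 0) :
    h =ᵐ[μ] 0 := by
  wlog hm : Measurable h generalizing h
  · obtain ⟨g, hg, hhg⟩ := hh.1.aemeasurable
    refine hhg.trans (this (hh.congr hhg) (fun L => ?_) hg)
    rw [← h0 L]
    refine integral_congr_ae ?_
    filter_upwards [hhg] with x hx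
    rw [hx]
  have hfin {g : E → ℝ} (hg : Integrable g μ) : ∫⁻ x, ENNReal.ofReal (g x) ∂μ ≠ ∞ :=
    (lt_of_le_of_lt (lintegral_mono fun x => Real.ofReal_le_enorm (g x)) hg.2).ne
  have e1 := isFiniteMeasure_withDensity (hfin hh)
  have e2 := isFiniteMeasure_withDensity (hfin hh.neg)
  have key : μ.withDensity (fun x => ENNReal.ofReal (h x)) =
      μ.withDensity (fun x => ENNReal.ofReal ((-h) x)) := by
    refine Measure.ext_of_charFunDual ?_
    ext L
    have hL : Measurable fun x : E => Complex.exp (L x * Complex.I) := by fun_prop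
    have hi {g : E → ℝ} (hg : Integrable g μ) : Integrable
        (fun x => (ENNReal.ofReal (g x)).toReal • Complex.exp (L x * Complex.I)) μ := by
      simp only [ENNReal.toReal_ofReal', Complex.real_smul]
      refine (hg.pos_part.ofReal (𝕜 := ℂ)).mul_bdd (c := 1) hL.aestronglyMeasurable
        (Filter.Eventually.of_forall fun x => (Complex.norm_exp_ofReal_mul_I _).le)
    rw [charFunDual_apply, charFunDual_apply,
      integral_withDensity_eq_integral_toReal_smul (by fun_prop) (by simp),
      integral_withDensity_eq_integral_toReal_smul (by fun_prop) (by simp), ← sub_eq_zero,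
      ← integral_sub (hi hh) (hi hh.neg), ← h0 L]
    congr 1
    ext x
    rw [← sub_smul, Complex.real_smul, mul_comm]
    congr 2
    simp only [ENNReal.toReal_ofReal', Pi.neg_apply]
    exact max_zero_sub_eq_self (h x)
  rw [withDensity_eq_iff (by fun_prop) (by fun_prop) (hfin hh)] at key
  filter_upwards [key] with x hx
  have hx' := congrArg ENNReal.toReal hx
  simp only [ENNReal.toReal_ofReal', Pi.neg_apply] at hx'
  rw [Pi.zero_apply, ← max_zero_sub_eq_self (h x), sub_eq_zero, hx']

/-- An integrable complex function whose Fourier transform vanishes is zero almost everywhere. -/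
theorem ae_eq_zero_of_integral_exp_mul_eq_zero {E : Type*} [NormedAddCommGroup E]
    [NormedSpace ℝ E] [MeasurableSpace E] [BorelSpace E] [SecondCountableTopology E]
    [CompleteSpace E] {μ : Measure E} {h : E → ℂ} (hh : Integrable h μ)
    (h0 : ∀ L : StrongDual ℝ E, ∫ x, Complex.exp (L x * Complex.I) * h x ∂μ = 0) :
    h =ᵐ[μ] 0 := by
  have hi (L : StrongDual ℝ E) {g : E → ℂ} (hg : Integrable g μ) :
      Integrable (fun x => Complex.exp (L x * Complex.I) * g x) μ :=
    hg.bdd_mul (c := 1) (by fun_prop)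
      (Filter.Eventually.of_forall fun x => (Complex.norm_exp_ofReal_mul_I _).le)
  have hc : Integrable (fun x => (starRingEnd ℂ) (h x)) μ :=
    hh.congr' hh.1.star (by simp)
  -- the conjugate of `h` has vanishing Fourier transform as well
  have h1 (L : StrongDual ℝ E) :
      ∫ x, Complex.exp (L x * Complex.I) * (starRingEnd ℂ) (h x) ∂μ = 0 := by
    rw [← map_zero (starRingEnd ℂ), ← h0 (-L), ← integral_conj]
    congr 1
    ext x
    simp [← Complex.exp_conj]
  have hre := ae_eq_zero_of_integral_exp_mul_ofReal_eq_zero hh.re fun L => by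
    have : ∀ x, Complex.exp (L x * Complex.I) * ((RCLike.re (h x) : ℝ) : ℂ) =
        (Complex.exp (L x * Complex.I) * h x +
          Complex.exp (L x * Complex.I) * (starRingEnd ℂ) (h x)) / 2 := fun x => by
      rw [RCLike.re_eq_complex_re, Complex.re_eq_add_conj]; ring
    simp_rw [this]
    rw [integral_div, integral_add (hi L hh) (hi L hc), h0, h1]
    simp
  have him := ae_eq_zero_of_integral_exp_mul_ofReal_eq_zero hh.im fun L => by
    have : ∀ x, Complex.exp (L x * Complex.I) * ((RCLike.im (h x) : ℝ) : ℂ) =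
        (Complex.exp (L x * Complex.I) * h x -
          Complex.exp (L x * Complex.I) * (starRingEnd ℂ) (h x)) / (2 * Complex.I) := fun x => by
      rw [RCLike.im_eq_complex_im, Complex.im_eq_sub_conj]; ring
    simp_rw [this]
    rw [integral_div, integral_sub (hi L hh) (hi L hc), h0, h1]
    simp
  filter_upwards [hre, him] with x h2 h3
  exact Complex.ext h2 h3

/-! ### Hilbert-Schmidt operators -/

/-- Parseval's identity. -/
theorem hasSum_norm_inner_sq {H : Type*} [NormedAddCommGroup H] [InnerProductSpace ℂ H]
    {κ : Type*} (b : HilbertBasis κ ℂ H) (x : H) :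
    HasSum (fun n => ‖(inner ℂ (b n) x : ℂ)‖ ^ 2) (‖x‖ ^ 2) := by
  have h := b.hasSum_inner_mul_inner x x
  rw [inner_self_eq_norm_sq_to_K] at h
  have h2 := Complex.hasSum_re h
  norm_cast at h2
  refine h2.congr_fun fun n => ?_
  rw [← inner_conj_symm x, RCLike.conj_mul]
  norm_cast

section HilbertSchmidt

variable {H : Type} [NormedAddCommGroup H] [InnerProductSpace ℂ H] [CompleteSpace H]

/-- Cyclicity of the trace for the product of the Hilbert-Schmidt operators `B` and `B * W`: the
double series `∑ ⟪B eₙ, eₘ⟫ ⟪eₘ, B W eₙ⟫` converges absolutely and can be summed in either order. -/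
theorem hasSum_inner_map_of_hasSum_mul {κ : Type*} (b : HilbertBasis κ ℂ H) {B W : H →L[ℂ] H}
    (hB : IsSelfAdjoint B) (hs : Summable fun n => ‖B (b n)‖ ^ 2) {z : ℂ}
    (hz : HasSum (fun n => (inner ℂ (b n) ((B * B * W) (b n)) : ℂ)) z) :
    HasSum (fun n => (inner ℂ (B (b n)) (W (B (b n))) : ℂ)) z := by
  have hB' (x y : H) : (inner ℂ (B x) y : ℂ) = inner ℂ x (B y) := by
    rw [← ContinuousLinearMap.adjoint_inner_right, hB.adjoint_eq]
  obtain ⟨W', hW'⟩ : ∃ W', W' = ContinuousLinearMap.adjoint W := ⟨_, rfl⟩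
  let f : κ × κ → ℂ := fun p => inner ℂ (B (b p.1)) (b p.2) * inner ℂ (b p.2) (B (W (b p.1)))
  have s1 : Summable fun p : κ × κ => ‖(inner ℂ (b p.2) (B (b p.1)) : ℂ)‖ ^ 2 := by
    rw [summable_prod_of_nonneg fun p => by positivity]
    refine ⟨fun n => (hasSum_norm_inner_sq b (B (b n))).summable, ?_⟩
    simpa only [(hasSum_norm_inner_sq b _).tsum_eq] using hs
  have s2 : Summable fun p : κ × κ => ‖(inner ℂ (b p.1) (W' (B (b p.2))) : ℂ)‖ ^ 2 := by
    suffices h : Summable fun p : κ × κ => ‖(inner ℂ (b p.2) (W' (B (b p.1))) : ℂ)‖ ^ 2 from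
      h.prod_symm
    rw [summable_prod_of_nonneg fun p => by positivity]
    refine ⟨fun n => (hasSum_norm_inner_sq b (W' (B (b n)))).summable, ?_⟩
    simp only [(hasSum_norm_inner_sq b _).tsum_eq]
    refine (hs.mul_left (‖W'‖ ^ 2)).of_nonneg_of_le (fun n => by positivity) fun n => ?_
    rw [← mul_pow]
    gcongr
    exact W'.le_opNorm _
  have s3 : Summable f := by
    refine (s1.add s2).of_norm_bounded fun p => ?_
    have e : ‖(inner ℂ (b p.2) (B (W (b p.1))) : ℂ)‖ = ‖(inner ℂ (b p.1) (W' (B (b p.2))) : ℂ)‖ := by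
      rw [hW', ContinuousLinearMap.adjoint_inner_right, norm_inner_symm, ← hB', norm_inner_symm,
        norm_inner_symm]
    rw [norm_mul, e, norm_inner_symm]
    nlinarith [sq_nonneg (‖(inner ℂ (b p.2) (B (b p.1)) : ℂ)‖ -
      ‖(inner ℂ (b p.1) (W' (B (b p.2))) : ℂ)‖), sq_nonneg (‖(inner ℂ (b p.2) (B (b p.1)) : ℂ)‖ +
      ‖(inner ℂ (b p.1) (W' (B (b p.2))) : ℂ)‖)]
  have h1 : HasSum (fun n => (inner ℂ (b n) ((B * B * W) (b n)) : ℂ)) (∑' p, f p) := by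
    refine s3.hasSum.prod_fiberwise fun n => ?_
    have := b.hasSum_inner_mul_inner (B (b n)) (B (W (b n)))
    rwa [hB'] at this
  have h2 : HasSum (fun m => (inner ℂ (B (b m)) (W (B (b m))) : ℂ)) (∑' p, f p) := by
    refine (((Equiv.prodComm κ κ).hasSum_iff).2 s3.hasSum).prod_fiberwise fun m => ?_
    have := b.hasSum_inner_mul_inner (W' (B (b m))) (B (b m))
    rw [hW', ContinuousLinearMap.adjoint_inner_left] at this
    refine this.congr_fun fun n => ?_
    simp only [f, Function.comp, Equiv.prodComm_apply, Prod.swap,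
      ContinuousLinearMap.adjoint_inner_left, hB']
    ring
  rwa [hz.unique h1]

theorem inner_sqrt_left (ρ : H →L[ℂ] H) (x y : H) :
    (inner ℂ (CFC.sqrt ρ x) y : ℂ) = inner ℂ x (CFC.sqrt ρ y) := by
  rw [← ContinuousLinearMap.adjoint_inner_right,
    (IsSelfAdjoint.of_nonneg (CFC.sqrt_nonneg ρ)).adjoint_eq]

theorem inner_sqrt_sqrt {ρ : H →L[ℂ] H} (hρ : ρ.IsPositive) (x y : H) :
    (inner ℂ (CFC.sqrt ρ x) (CFC.sqrt ρ y) : ℂ) = inner ℂ x (ρ y) := by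
  rw [inner_sqrt_left, ← _root_.mul_apply_eq_comp,
    CFC.sqrt_mul_sqrt_self ρ ((ContinuousLinearMap.nonneg_iff_isPositive ρ).2 hρ)]

/-- A state `ρ` is a sum `∑ |xₙ⟩⟨xₙ|` of rank-one operators with square-summable `xₙ`, and its
expectation values are the sums of those of the `xₙ`. The columns `xₙ = √ρ eₙ` do this. -/
theorem IsState.exists_hasSum_inner {ρ : H →L[ℂ] H} (hρ : IsState ρ) :
    ∃ (κ : Type) (x : κ → H), (Summable fun n => ‖x n‖ ^ 2) ∧
      (∀ f g, HasSum (fun n => (inner ℂ f (x n) * inner ℂ (x n) g : ℂ)) (inner ℂ f (ρ g))) ∧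
      ∀ (W : H →L[ℂ] H) (z : ℂ), HasTrace (ρ * W) z →
        HasSum (fun n => (inner ℂ (x n) (W (x n)) : ℂ)) z := by
  obtain ⟨w, b, -⟩ := exists_hilbertBasis ℂ H
  have hs : Summable fun n => ‖CFC.sqrt ρ (b n)‖ ^ 2 := by
    refine (Complex.hasSum_re (hρ.2 w b)).summable.congr fun n => ?_
    rw [← inner_sqrt_sqrt hρ.1, inner_self_eq_norm_sq_to_K]
    norm_cast
  refine ⟨w, fun n => CFC.sqrt ρ (b n), hs, fun f g => ?_, fun W z hz => ?_⟩
  · have h := b.hasSum_inner_mul_inner (CFC.sqrt ρ f) (CFC.sqrt ρ g)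
    rw [inner_sqrt_sqrt hρ.1] at h
    simpa only [inner_sqrt_left] using h
  · refine hasSum_inner_map_of_hasSum_mul b (IsSelfAdjoint.of_nonneg (CFC.sqrt_nonneg ρ)) hs ?_
    rw [CFC.sqrt_mul_sqrt_self ρ ((ContinuousLinearMap.nonneg_iff_isPositive ρ).2 hρ.1)]
    exact hz w b

end HilbertSchmidt

/-! ### The characteristic function determines the state -/

theorem integral_norm_sq_eq {α : Type*} [MeasurableSpace α] {μ : Measure α} (f : Lp ℂ 2 μ) :
    ∫ q, ‖f q‖ ^ 2 ∂μ = ‖f‖ ^ 2 := by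
  have h := L2.inner_def (𝕜 := ℂ) f f
  simp_rw [inner_self_eq_norm_sq_to_K] at h
  norm_cast at h
  exact_mod_cast h.symm

theorem integrable_norm_sq {α : Type*} [MeasurableSpace α] {μ : Measure α} (f : Lp ℂ 2 μ) :
    Integrable (fun q => ‖f q‖ ^ 2) μ :=
  (Lp.memLp f).integrable_norm_pow two_ne_zero

/-- The Cauchy-Schwarz inequality in `L²`. -/
theorem integral_norm_mul_conj_le {α : Type*} [MeasurableSpace α] {μ : Measure α}
    (f g : Lp ℂ 2 μ) :
    ∫ q, ‖f q * (starRingEnd ℂ) (g q)‖ ∂μ ≤ ‖f‖ * ‖g‖ := by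
  simp_rw [norm_mul, RCLike.norm_conj]
  have h := integral_mul_norm_le_Lp_mul_Lq (μ := μ) (f := f) (g := g) Real.HolderConjugate.two_two
    (by simpa using Lp.memLp f) (by simpa using Lp.memLp g)
  simp only [Real.rpow_two, integral_norm_sq_eq, ← Real.sqrt_eq_rpow, norm_nonneg,
    Real.sqrt_sq] at h
  exact h

section Weyl

variable {ι : Type} [Fintype ι]

theorem inner_weyl_eq_integral (r : ι × Fin 2 → ℝ) (x y : ModeSpace ι) :
    (inner ℂ x (weyl r y) : ℂ) =
      ∫ q : ι → ℝ, weylPhase r q * ((starRingEnd ℂ) (x q) * y (q + fun k => r (k, 1))) := by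
  rw [L2.inner_def]
  refine integral_congr_ae ?_
  filter_upwards [weyl_apply r y] with q hq
  rw [hq, RCLike.inner_apply]
  ring

theorem aestronglyMeasurable_comp_add (y : ModeSpace ι) (b : ι → ℝ) :
    AEStronglyMeasurable (fun q : ι → ℝ => y (q + b)) volume :=
  (Lp.aestronglyMeasurable y).comp_measurePreserving (measurePreserving_add_right volume b)

theorem integrable_conj_mul_comp_add (x y : ModeSpace ι) (b : ι → ℝ) :
    Integrable (fun q : ι → ℝ => (starRingEnd ℂ) (x q) * y (q + b)) ∧
      ∫ q : ι → ℝ, ‖(starRingEnd ℂ) (x q) * y (q + b)‖ ≤ ‖x‖ ^ 2 + ‖y‖ ^ 2 := by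
  have hx := integrable_norm_sq x
  have hy : Integrable (fun q : ι → ℝ => ‖y (q + b)‖ ^ 2) :=
    (integrable_norm_sq y).comp_add_right b
  have hle (q : ι → ℝ) : ‖(starRingEnd ℂ) (x q) * y (q + b)‖ ≤ ‖x q‖ ^ 2 + ‖y (q + b)‖ ^ 2 := by
    rw [norm_mul, RCLike.norm_conj]
    nlinarith [sq_nonneg (‖x q‖ - ‖y (q + b)‖), sq_nonneg (‖x q‖ + ‖y (q + b)‖)]
  have hi : Integrable (fun q : ι → ℝ => (starRingEnd ℂ) (x q) * y (q + b)) :=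
    (hx.add hy).mono' ((Lp.aestronglyMeasurable x).star.mul (aestronglyMeasurable_comp_add y b))
      (Filter.Eventually.of_forall hle)
  refine ⟨hi, (integral_mono hi.norm (hx.add hy) hle).trans_eq ?_⟩
  simp only [Pi.add_apply]
  rw [integral_add hx hy, integral_norm_sq_eq, integral_add_right_eq_self (fun q => ‖y q‖ ^ 2),
    integral_norm_sq_eq]

/-- If `∑ ⟪xₙ, W(r) yₙ⟫ = 0` for all Weyl operators `W(r)`, then for every shift `b` the diagonal
`q ↦ ∑ conj (xₙ q) yₙ (q + b)` of the integral kernel of `∑ |yₙ⟩⟨xₙ|` vanishes: the sums with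
`r = (a, b)` are, up to phases, its Fourier coefficients. -/
theorem tsum_conj_mul_comp_add_ae_eq_zero {κ : Type*} [Countable κ] {x y : κ → ModeSpace ι}
    (hx : Summable fun n => ‖x n‖ ^ 2) (hy : Summable fun n => ‖y n‖ ^ 2)
    (h : ∀ r, HasSum (fun n => (inner ℂ (x n) (weyl r (y n)) : ℂ)) 0) (b : ι → ℝ) :
    (fun q : ι → ℝ => ∑' n, (starRingEnd ℂ) (x n q) * y n (q + b)) =ᵐ[volume] 0 := by
  classical
  have hint n := (integrable_conj_mul_comp_add (x n) (y n) b).1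
  have hsum : Summable fun n => ∫ q : ι → ℝ, ‖(starRingEnd ℂ) (x n q) * y n (q + b)‖ :=
    (hx.add hy).of_nonneg_of_le (fun n => integral_nonneg fun q => norm_nonneg _)
      fun n => (integrable_conj_mul_comp_add (x n) (y n) b).2
  refine ae_eq_zero_of_integral_exp_mul_eq_zero
    (integrable_tsum_of_summable_integral_norm hint hsum) fun L => ?_
  let r : ι × Fin 2 → ℝ := fun p => if p.2 = 0 then L (fun j => if p.1 = j then 1 else 0) else b p.1
  have hphase (q : ι → ℝ) : weylPhase r q =
      Complex.exp (L q * Complex.I) * weylPhase r 0 := by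
    have hL : L q = ∑ k, r (k, 0) * q k := by
      have := LinearMap.pi_apply_eq_sum_univ (L : (ι → ℝ) →ₗ[ℝ] ℝ) q
      simpa [r, mul_comm] using this
    rw [weylPhase, weylPhase, ← Complex.exp_add, hL]
    congr 1
    simp only [Pi.zero_apply, mul_zero, Finset.sum_const_zero, zero_add]
    push_cast
    ring
  have hr : (fun k => r (k, 1)) = b := by ext k; simp [r]
  have hbd (q : ι → ℝ) : ‖Complex.exp (L q * Complex.I)‖ = 1 := Complex.norm_exp_ofReal_mul_I _
  have key := hasSum_integral_of_summable_integral_norm (μ := (volume : Measure (ι → ℝ)))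
    (F := fun n q => Complex.exp (L q * Complex.I) * ((starRingEnd ℂ) (x n q) * y n (q + b)))
    (fun n => (hint n).bdd_mul (c := 1) (by fun_prop)
      (Filter.Eventually.of_forall fun q => (hbd q).le))
    (hsum.congr fun n => by
      congr 1
      ext q
      rw [norm_mul (Complex.exp _), hbd, one_mul])
  have h0 := h r
  simp_rw [inner_weyl_eq_integral, hr] at h0
  have hfac n : ∫ q : ι → ℝ, weylPhase r q * ((starRingEnd ℂ) (x n q) * y n (q + b)) =
      weylPhase r 0 * ∫ q : ι → ℝ,
        Complex.exp (L q * Complex.I) * ((starRingEnd ℂ) (x n q) * y n (q + b)) := by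
    rw [← integral_const_mul]
    refine integral_congr_ae (Filter.Eventually.of_forall fun q => ?_)
    simp only [hphase q]
    ring
  simp_rw [hfac] at h0
  have h1 := (key.mul_left (weylPhase r 0)).unique h0
  have hne : weylPhase r 0 ≠ 0 := Complex.exp_ne_zero _
  simpa only [tsum_mul_left] using (mul_eq_zero.1 h1).resolve_left hne

/-- The Weyl operators separate the trace-class operators `∑ |yₙ⟩⟨xₙ|`. The diagonals of the kernel
vanish, and integrating them over all shifts against `f` and `g` gives the matrix element
`⟪f, · g⟫`. -/
theorem hasSum_inner_mul_inner_of_weyl {κ : Type*} {x y : κ → ModeSpace ι}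
    (hx : Summable fun n => ‖x n‖ ^ 2) (hy : Summable fun n => ‖y n‖ ^ 2)
    (h : ∀ r, HasSum (fun n => (inner ℂ (x n) (weyl r (y n)) : ℂ)) 0) (f g : ModeSpace ι) :
    HasSum (fun n => (inner ℂ f (y n) * inner ℂ (x n) g : ℂ)) 0 := by
  -- only countably many `x n` are nonzero
  wlog hκ : Countable κ generalizing κ
  · let S : Set κ := Function.support fun n => ‖x n‖ ^ 2
    have hS {n : κ} (hn : x n ≠ 0) : n ∈ S := by simpa [S] using hn
    have hr := this (κ := S) (x := fun n => x n) (y := fun n => y n) (hx.subtype _) (hy.subtype _)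
      (fun r => (hasSum_subtype_iff_of_support_subset
        (f := fun n => (inner ℂ (x n) (weyl r (y n)) : ℂ)) fun n hn => hS fun h0 => hn ?_).2 (h r))
      hx.countable_support
    · refine (hasSum_subtype_iff_of_support_subset
        (f := fun n => (inner ℂ f (y n) * inner ℂ (x n) g : ℂ)) fun n hn => hS fun h0 => hn ?_).1 hr
      simp [h0]
    · simp [h0]
  let G : κ → (ι → ℝ) → ℂ := fun n q => g q * (starRingEnd ℂ) (x n q)
  let K : κ → (ι → ℝ) → ℂ := fun n q => y n q * (starRingEnd ℂ) (f q)
  have hG n : Integrable (G n) := L2.integrable_inner (𝕜 := ℂ) (x n) g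
  have hK n : Integrable (K n) := L2.integrable_inner (𝕜 := ℂ) f (y n)
  have hshear := measurePreserving_prod_add (volume : Measure (ι → ℝ)) (volume : Measure (ι → ℝ))
  have hGK n : Integrable (fun z : (ι → ℝ) × (ι → ℝ) => G n z.1 * K n z.2) (volume.prod volume) :=
    (hG n).mul_prod (hK n)
  have hF n : Integrable (fun z : (ι → ℝ) × (ι → ℝ) => G n z.1 * K n (z.1 + z.2))
      (volume.prod volume) := hshear.integrable_comp_of_integrable (hGK n)
  have hchange {E : Type} [NormedAddCommGroup E] [NormedSpace ℝ E]
      (φ : (ι → ℝ) × (ι → ℝ) → E) : ∫ z, φ (z.1, z.1 + z.2) ∂(volume.prod volume) =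
        ∫ z, φ z ∂(volume.prod volume) :=
    hshear.integral_comp (MeasurableEquiv.shearAddRight (ι → ℝ)).measurableEmbedding φ
  have hFs : Summable fun n => ∫ z : (ι → ℝ) × (ι → ℝ), ‖G n z.1 * K n (z.1 + z.2)‖
      ∂(volume.prod volume) := by
    refine (((hx.add hy).mul_left (‖g‖ * ‖f‖))).of_nonneg_of_le
      (fun n => integral_nonneg fun q => norm_nonneg _) fun n => ?_
    rw [hchange (fun z => ‖G n z.1 * K n z.2‖)]
    simp_rw [norm_mul]
    rw [integral_prod_mul (fun q => ‖G n q‖) (fun q => ‖K n q‖)]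
    refine (mul_le_mul (integral_norm_mul_conj_le g (x n)) (integral_norm_mul_conj_le (y n) f)
      (integral_nonneg fun q => norm_nonneg _) (by positivity)).trans ?_
    have : ‖x n‖ * ‖y n‖ ≤ ‖x n‖ ^ 2 + ‖y n‖ ^ 2 := by
      nlinarith [sq_nonneg (‖x n‖ - ‖y n‖), sq_nonneg (‖x n‖ + ‖y n‖)]
    calc ‖g‖ * ‖x n‖ * (‖y n‖ * ‖f‖) = ‖g‖ * ‖f‖ * (‖x n‖ * ‖y n‖) := by ring
      _ ≤ _ := by gcongr
  have key := hasSum_integral_of_summable_integral_norm hF hFs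
  have hterm n : ∫ z : (ι → ℝ) × (ι → ℝ), G n z.1 * K n (z.1 + z.2) ∂(volume.prod volume) =
      inner ℂ f (y n) * inner ℂ (x n) g := by
    rw [hchange (fun z => G n z.1 * K n z.2), integral_prod_mul, L2.inner_def, L2.inner_def,
      mul_comm]
    rfl
  have hzero : ∫ z : (ι → ℝ) × (ι → ℝ), ∑' n, G n z.1 * K n (z.1 + z.2)
      ∂(volume.prod volume) = 0 := by
    rw [integral_prod_symm _ (integrable_tsum_of_summable_integral_norm hF hFs)]
    refine integral_eq_zero_of_ae (Filter.Eventually.of_forall fun b => ?_)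
    refine integral_eq_zero_of_ae ?_
    filter_upwards [tsum_conj_mul_comp_add_ae_eq_zero hx hy h b] with q hq
    have e n : G n q * K n (q + b) = g q * (starRingEnd ℂ) (f (q + b)) *
        ((starRingEnd ℂ) (x n q) * y n (q + b)) := by
      simp only [G, K]; ring
    simp only [e]
    rw [tsum_mul_left, hq, Pi.zero_apply, mul_zero]
  simp_rw [hterm] at key
  rwa [hzero] at key

/-- A state is determined by its characteristic function `r ↦ Tr (ρ W(r))`. -/
theorem IsState.eq_of_hasTrace_weyl {ρ σ : ModeSpace ι →L[ℂ] ModeSpace ι} (hρ : IsState ρ)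
    (hσ : IsState σ) {χ : (ι × Fin 2 → ℝ) → ℂ} (h1 : ∀ r, HasTrace (ρ * weyl r) (χ r))
    (h2 : ∀ r, HasTrace (σ * weyl r) (χ r)) : ρ = σ := by
  obtain ⟨κ, x, hx, hxρ, hxW⟩ := hρ.exists_hasSum_inner
  obtain ⟨κ', x', hx', hxσ, hxW'⟩ := hσ.exists_hasSum_inner
  -- `ρ - σ` is the sum of the `|xₙ⟩⟨xₙ|` and the `|-x'ₙ⟩⟨x'ₙ|`
  let X : κ ⊕ κ' → ModeSpace ι := Sum.elim x x'
  let Y : κ ⊕ κ' → ModeSpace ι := Sum.elim x fun n => -x' n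
  have hX : Summable fun n => ‖X n‖ ^ 2 :=
    (hx.hasSum.sum (f := fun n => ‖X n‖ ^ 2) hx'.hasSum).summable
  have hY : Summable fun n => ‖Y n‖ ^ 2 := by
    refine hX.congr fun n => ?_
    cases n <;> simp [X, Y]
  have hW (r : ι × Fin 2 → ℝ) : HasSum (fun n => (inner ℂ (X n) (weyl r (Y n)) : ℂ)) 0 := by
    rw [← add_neg_cancel (χ r)]
    refine HasSum.sum (f := fun n => (inner ℂ (X n) (weyl r (Y n)) : ℂ)) (hxW _ _ (h1 r)) ?_
    simpa [X, Y, Function.comp_def] using (hxW' _ _ (h2 r)).neg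
  refine ContinuousLinearMap.ext fun g => ext_inner_left ℂ fun f => ?_
  have hfg := hasSum_inner_mul_inner_of_weyl hX hY hW f g
  have hfg' : HasSum (fun n => (inner ℂ f (Y n) * inner ℂ (X n) g : ℂ))
      (inner ℂ f (ρ g) + -inner ℂ f (σ g)) := by
    refine HasSum.sum (f := fun n => (inner ℂ f (Y n) * inner ℂ (X n) g : ℂ)) (hxρ f g) ?_
    simpa [X, Y, Function.comp_def] using (hxσ f g).neg
  exact (add_neg_eq_zero.1 (hfg'.unique hfg))

end Weyl

/-! ### Unitary invariance of the fidelity -/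

section Unitary

variable {H K : Type} [NormedAddCommGroup H] [InnerProductSpace ℂ H] [CompleteSpace H]
  [NormedAddCommGroup K] [InnerProductSpace ℂ K] [CompleteSpace K]

theorem inner_conjStarAlgEquiv_apply (U : H ≃ₗᵢ[ℂ] K) (A : H →L[ℂ] H) (x y : K) :
    (inner ℂ x (U.conjStarAlgEquiv A y) : ℂ) = inner ℂ (U.symm x) (A (U.symm y)) := by
  rw [LinearIsometryEquiv.conjStarAlgEquiv_apply_apply, ← U.inner_map_map (U.symm x),
    U.apply_symm_apply]

theorem HasTrace.conjStarAlgEquiv {A : H →L[ℂ] H} {z : ℂ} (hA : HasTrace A z)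
    (U : H ≃ₗᵢ[ℂ] K) : HasTrace (U.conjStarAlgEquiv A) z := by
  intro κ b
  refine (hA κ (HilbertBasis.ofRepr (U.trans b.repr))).congr_fun fun n => ?_
  rw [inner_conjStarAlgEquiv_apply]
  rfl

theorem nonneg_conjStarAlgEquiv {A : H →L[ℂ] H} (hA : 0 ≤ A) (U : H ≃ₗᵢ[ℂ] K) :
    0 ≤ U.conjStarAlgEquiv A := by
  rw [ContinuousLinearMap.nonneg_iff_isPositive, ContinuousLinearMap.isPositive_def'] at hA ⊢
  refine ⟨hA.1.map U.conjStarAlgEquiv, fun x => ?_⟩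
  have := hA.2 (U.symm x)
  rw [ContinuousLinearMap.reApplyInnerSelf_apply, inner_re_symm] at this ⊢
  rwa [inner_conjStarAlgEquiv_apply]

theorem IsState.conjStarAlgEquiv {ρ : H →L[ℂ] H} (hρ : IsState ρ) (U : H ≃ₗᵢ[ℂ] K) :
    IsState (U.conjStarAlgEquiv ρ) := by
  refine ⟨?_, hρ.2.conjStarAlgEquiv U⟩
  rw [← ContinuousLinearMap.nonneg_iff_isPositive]
  exact nonneg_conjStarAlgEquiv ((ContinuousLinearMap.nonneg_iff_isPositive ρ).2 hρ.1) U

theorem posTrace_conjStarAlgEquiv (U : H ≃ₗᵢ[ℂ] K) (A : H →L[ℂ] H) :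
    posTrace (U.conjStarAlgEquiv A) = posTrace A := by
  have hle {H K : Type} [NormedAddCommGroup H] [InnerProductSpace ℂ H] [CompleteSpace H]
      [NormedAddCommGroup K] [InnerProductSpace ℂ K] [CompleteSpace K] (U : H ≃ₗᵢ[ℂ] K)
      (A : H →L[ℂ] H) : posTrace (U.conjStarAlgEquiv A) ≤ posTrace A := by
    refine iSup₂_le fun t ht => ?_
    have ht' : Orthonormal ℂ
        (fun e : t.map U.symm.toEquiv.toEmbedding => (e : H)) := by
      have h1 := ht.comp_linearIsometryEquiv U.symm
      let g : t.map U.symm.toEquiv.toEmbedding → t := fun e => ⟨U e, by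
        obtain ⟨x, hx, hxe⟩ := Finset.mem_map.1 e.2
        rw [← hxe]
        simpa using hx⟩
      have h2 := h1.comp g fun a b hab => Subtype.ext (U.injective (congrArg Subtype.val hab))
      convert h2 using 2 with e
      exact (U.symm_apply_apply _).symm
    refine le_iSup₂_of_le _ ht' ?_
    rw [Finset.sum_map]
    simp only [inner_conjStarAlgEquiv_apply]
    rfl
  refine le_antisymm (hle U A) ?_
  have h := hle U.symm (U.conjStarAlgEquiv A)
  rwa [← LinearIsometryEquiv.symm_conjStarAlgEquiv, StarAlgEquiv.symm_apply_apply] at h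

theorem sqrt_conjStarAlgEquiv (U : H ≃ₗᵢ[ℂ] K) {A : H →L[ℂ] H} (hA : 0 ≤ A) :
    CFC.sqrt (U.conjStarAlgEquiv A) = U.conjStarAlgEquiv (CFC.sqrt A) := by
  refine CFC.sqrt_unique ?_ (nonneg_conjStarAlgEquiv (CFC.sqrt_nonneg A) U)
  rw [← map_mul, CFC.sqrt_mul_sqrt_self A hA]

theorem fidelity_conjStarAlgEquiv (U : H ≃ₗᵢ[ℂ] K) {ρ σ : H →L[ℂ] H} (hρ : 0 ≤ ρ) (hσ : 0 ≤ σ) :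
    fidelity (U.conjStarAlgEquiv ρ) (U.conjStarAlgEquiv σ) = fidelity ρ σ := by
  have h : 0 ≤ CFC.sqrt ρ * σ * CFC.sqrt ρ :=
    (IsSelfAdjoint.of_nonneg (CFC.sqrt_nonneg ρ)).conjugate_nonneg hσ
  rw [fidelity, fidelity, sqrt_conjStarAlgEquiv U hρ, ← map_mul, ← map_mul,
    sqrt_conjStarAlgEquiv U h, posTrace_conjStarAlgEquiv]

end Unitary

/-! ### Permutations of the modes -/

section Permutation

variable {ι : Type} [Fintype ι]

theorem measurePreserving_comp_perm (e : Equiv.Perm ι) :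
    MeasurePreserving (fun q : ι → ℝ => q ∘ e) volume volume := by
  have h := volume_measurePreserving_piCongrLeft (fun _ : ι => ℝ) e.symm
  convert h using 1
  ext q k
  rw [MeasurableEquiv.coe_piCongrLeft, ← e.symm_apply_apply k, Equiv.piCongrLeft_apply_apply]
  simp

/-- The isometry `f ↦ (q ↦ f (q ∘ e))` of `L²(ℝ^ι)`, which relabels the modes by `e`. -/
noncomputable def permIsometry (e : Equiv.Perm ι) : ModeSpace ι →ₗᵢ[ℂ] ModeSpace ι :=
  Lp.compMeasurePreservingₗᵢ ℂ (fun q : ι → ℝ => q ∘ e) (measurePreserving_comp_perm e)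

theorem permIsometry_apply (e : Equiv.Perm ι) (f : ModeSpace ι) :
    ∀ᵐ q : ι → ℝ, permIsometry e f q = f (q ∘ e) :=
  Lp.coeFn_compMeasurePreserving f (measurePreserving_comp_perm e)

/-- The unitary operator `f ↦ (q ↦ f (q ∘ e))` on `L²(ℝ^ι)`. -/
noncomputable def permUnitary (e : Equiv.Perm ι) : ModeSpace ι ≃ₗᵢ[ℂ] ModeSpace ι :=
  LinearIsometryEquiv.ofSurjective (permIsometry e) fun f => ⟨permIsometry e.symm f, by
    refine Lp.ext ?_
    filter_upwards [permIsometry_apply e (permIsometry e.symm f),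
      (measurePreserving_comp_perm e).quasiMeasurePreserving.ae (permIsometry_apply e.symm f)]
      with q h1 h2
    rw [h1, h2, Function.comp_assoc, e.self_comp_symm, Function.comp_id]⟩

/-- The action of a permutation of the modes on the phase-space slots. -/
def slotPerm (e : Equiv.Perm ι) : Equiv.Perm (ι × Fin 2) := e.prodCongr (Equiv.refl _)

theorem permUnitary_weyl (e : Equiv.Perm ι) (r : ι × Fin 2 → ℝ) (f : ModeSpace ι) :
    permUnitary e (weyl (r ∘ slotPerm e) f) = weyl r (permUnitary e f) := by
  change permIsometry e _ = weyl r (permIsometry e f)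
  refine Lp.ext ?_
  filter_upwards [permIsometry_apply e (weyl (r ∘ slotPerm e) f),
    (measurePreserving_comp_perm e).quasiMeasurePreserving.ae (weyl_apply (r ∘ slotPerm e) f),
    weyl_apply r (permIsometry e f),
    (measurePreserving_add_right (volume : Measure (ι → ℝ))
      fun k => r (k, 1)).quasiMeasurePreserving.ae (permIsometry_apply e f)] with q h1 h2 h3 h4
  rw [h1, h2, h3, h4]
  have hp : weylPhase (r ∘ slotPerm e) (q ∘ e) = weylPhase r q := by
    have e1 := Equiv.sum_comp e fun k => r (k, 0) * q k
    have e2 := Equiv.sum_comp e fun k => r (k, 0) * r (k, 1)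
    simp only [weylPhase, ← e1, ← e2]
    rfl
  rw [hp]
  rfl

theorem conjStarAlgEquiv_permUnitary_weyl (e : Equiv.Perm ι) (r : ι × Fin 2 → ℝ) :
    (permUnitary e).conjStarAlgEquiv (weyl (r ∘ slotPerm e)) = weyl r := by
  refine ContinuousLinearMap.ext fun f => ?_
  rw [LinearIsometryEquiv.conjStarAlgEquiv_apply_apply, permUnitary_weyl,
    LinearIsometryEquiv.apply_symm_apply]

/-- There is at most one centred Gaussian state with a given covariance matrix. -/
theorem IsGaussianState.eq {V : Matrix (ι × Fin 2) (ι × Fin 2) ℝ}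
    {ρ σ : ModeSpace ι →L[ℂ] ModeSpace ι} (hρ : IsGaussianState V ρ) (hσ : IsGaussianState V σ) :
    ρ = σ :=
  hρ.1.eq_of_hasTrace_weyl hσ.1 hρ.2 hσ.2

/-- Conjugation by `permUnitary e` undoes the relabelling of the covariance matrix by `e`. -/
theorem IsGaussianState.conj_permUnitary (e : Equiv.Perm ι)
    {V : Matrix (ι × Fin 2) (ι × Fin 2) ℝ} {ρ : ModeSpace ι →L[ℂ] ModeSpace ι}
    (hρ : IsGaussianState (V.submatrix (slotPerm e) (slotPerm e)) ρ) :
    IsGaussianState V ((permUnitary e).conjStarAlgEquiv ρ) := by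
  refine ⟨hρ.1.conjStarAlgEquiv _, fun r => ?_⟩
  have h := (hρ.2 (r ∘ slotPerm e)).conjStarAlgEquiv (permUnitary e)
  have hV : (r ∘ slotPerm e) ⬝ᵥ (V.submatrix (slotPerm e) (slotPerm e)).mulVec (r ∘ slotPerm e) =
      r ⬝ᵥ V.mulVec r := by
    rw [Matrix.submatrix_mulVec_equiv, Function.comp_assoc, Equiv.self_comp_symm,
      Function.comp_id, comp_equiv_dotProduct_comp_equiv]
  rwa [hV, map_mul, conjStarAlgEquiv_permUnitary_weyl] at h

variable [DecidableEq ι]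

/-- The GHZ covariance matrix is symmetric under permutations of the modes, so that permuting the
modes of an output state amounts to permuting the pattern. -/
theorem multiChannelCov_ghzCov_submatrix (e : Equiv.Perm ι) (μ : ℝ) (τ ν : Bool → ℝ)
    (i : ι → Bool) :
    (multiChannelCov τ ν i (ghzCov ι μ)).submatrix (slotPerm e) (slotPerm e) =
      multiChannelCov τ ν (i ∘ e) (ghzCov ι μ) := by
  ext ⟨k, a⟩ ⟨l, b⟩
  simp [multiChannelCov, patternMatrix, Matrix.diagonal_apply, ghzCov, slotPerm,
    Matrix.mul_diagonal, Matrix.diagonal_mul, Matrix.diagonal_transpose]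

end Permutation

/-! ### Pairs of patterns up to permutation -/

theorem exists_perm_comp_eq {ι γ : Type*} [Fintype ι] [DecidableEq γ] {f g : ι → γ}
    (h : ∀ c, (Finset.univ.filter fun k => f k = c).card =
      (Finset.univ.filter fun k => g k = c).card) : ∃ e : Equiv.Perm ι, g ∘ e = f := by
  have h' (c : γ) : Nonempty ({k // f k = c} ≃ {k // g k = c}) :=
    ⟨Fintype.equivOfCardEq (by rw [Fintype.card_subtype, Fintype.card_subtype, h])⟩
  exact ⟨Equiv.ofFiberEquiv fun c => (h' c).some, funext (Equiv.ofFiberEquiv_map _)⟩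

theorem card_filter_pair {ι : Type*} [Fintype ι] [DecidableEq ι] (p q : ι → Bool) :
    let N := fun a b => (Finset.univ.filter fun k => (p k, q k) = (a, b)).card
    (Finset.univ.filter fun k => p k = true).card = N true true + N true false ∧
    (Finset.univ.filter fun k => q k = true).card = N true true + N false true ∧
    hammingDist p q = N true false + N false true ∧
    Fintype.card ι = N true true + N true false + N false true + N false false := by
  simp only [hammingDist, Finset.card_filter, ← Finset.sum_add_distrib, Fintype.card_eq_sum_ones]
  refine ⟨?_, ?_, ?_, ?_⟩ <;> refine Finset.sum_congr rfl fun k _ => ?_ <;>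
    cases p k <;> cases q k <;> rfl

/-- The weights of two patterns and their Hamming distance determine how often each of the four
pairs of channel types occurs, and hence the pair of patterns up to a common permutation. -/
theorem exists_perm_pattern_pair {ι : Type} [Fintype ι] [DecidableEq ι] {v u : ℕ}
    {i i' j j' : ι → Bool}
    (hi : i ∈ cpfSpace ι v) (hi' : i' ∈ cpfSpace ι u) (hj : j ∈ cpfSpace ι v)
    (hj' : j' ∈ cpfSpace ι u) (h : hammingDist i i' = hammingDist j j') :
    ∃ e : Equiv.Perm ι, j ∘ e = i ∧ j' ∘ e = i' := by
  have hc := card_filter_pair i i'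
  have hc' := card_filter_pair j j'
  simp only [cpfSpace, Set.mem_ofPred_eq] at hi hi' hj hj'
  simp only [hi, hi', hj, hj', h] at hc hc'
  obtain ⟨e, he⟩ := exists_perm_comp_eq (f := fun k => (i k, i' k)) (g := fun k => (j k, j' k)) (by
    rintro ⟨_ | _, _ | _⟩ <;> omega)
  exact ⟨e, funext fun k => congrArg Prod.fst (congrFun he k),
    funext fun k => congrArg Prod.snd (congrFun he k)⟩

theorem corollary1 {m : ℕ} (s : Finset (Fin m)) (hs : 2 ≤ s.card)
    (μ : ℝ) (hμ : 1 / 2 ≤ μ)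
    (τ ν : Bool → ℝ) (hch : ∀ x, IsGPIChannel (τ x) (ν x))
    (v u d : ℕ) (hd : 0 < d)
    (U V : Set (s → Bool)) (hU : U ⊆ cpfSpace s v) (hV : V ⊆ cpfSpace s u)
    (i i' j j' : Fin m → Bool)
    (hi : localPattern i s ∈ U) (hi' : localPattern i' s ∈ V)
    (hj : localPattern j s ∈ U) (hj' : localPattern j' s ∈ V)
    (hii' : hammingDist (localPattern i s) (localPattern i' s) = d)
    (hjj' : hammingDist (localPattern j s) (localPattern j' s) = d)
    (ρ ρ' σ σ' : ModeSpace s →L[ℂ] ModeSpace s)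
    (hρ : IsOutputSubState s μ τ ν i ρ) (hρ' : IsOutputSubState s μ τ ν i' ρ')
    (hσ : IsOutputSubState s μ τ ν j σ) (hσ' : IsOutputSubState s μ τ ν j' σ') :
    fidelity ρ ρ' = fidelity σ σ' := by
  obtain ⟨e, he, he'⟩ := exists_perm_pattern_pair (hU hi) (hV hi') (hU hj) (hV hj')
    (hii'.trans hjj'.symm)
  unfold IsOutputSubState at hρ hρ' hσ hσ'
  rw [← he, ← multiChannelCov_ghzCov_submatrix] at hρ
  rw [← he', ← multiChannelCov_ghzCov_submatrix] at hρ'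
  rw [hσ.eq (hρ.conj_permUnitary e), hσ'.eq (hρ'.conj_permUnitary e)]
  exact (fidelity_conjStarAlgEquiv _
    ((ContinuousLinearMap.nonneg_iff_isPositive ρ).2 hρ.1.1)
    ((ContinuousLinearMap.nonneg_iff_isPositive ρ').2 hρ'.1.1)).symm
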